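/- Let $n\ge 2$ be an integer, $B_R=\{x\in\mathbb{R}^n : |x|<R\}$, and assume $0<R<\sqrt{\tfrac38(3n-5)(2n-3)^3}$. Put $\alpha=\sqrt[3]{9n-15}$, $u^*(r)=-\alpha r^{1/3}$, $\nu=\tfrac16\sqrt{36n^2-96n+61}$, and write $u_r=\nabla u\cdot x/|x|$ and $r=|x|$. Let $u_0:\overline{B}_R\to\mathbb{R}$ satisfy: $u_0\in C^2(\overline{B}_R\setminus\{0\})$; $u_0$ is radially symmetric; $u_0\le u^*$; $\limsup_{r\searrow 0}|r^{3/2-n-\nu}(u^*(r)-u_0(r))|<\infty$; $u_0(R)=u^*(R)$; and there is $c>0$ such that $0\ge u_{0r}(r)\ge -c\,r^{-2/3}$ for all $r\in(0,R)$. Let $u\in C(\overline{B}_R\times[0,\infty))\cap C^{2,1}((B_R\setminus\{0\})\times(0,\infty))$ be a classical solution of $$u_t=\Delta u+u\,u_r^3\ \text{ in }(B_R\setminus\{0\})\times(0,\infty),\qquad u(0,t)=0,\quad u|_{\partial B_R}(\cdot,t)=u^*(R)\ \text{ for } t>0,\qquad u(\cdot,0)=u_0\ \text{ in }\overline{B}_R.$$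 Then $u(\cdot,t)\to u^*(|\cdot|)$ as $t\to\infty$, uniformly in $B_R$ and with an exponential rate: there are $\mu>0$, depending only on $n$ and $R$, and $C>0$, depending only on $n$, $R$ and $u_0$, such that $$|u(x,t)-u^*(|x|)|\le C e^{-\mu t}\qquad\text{for all }x\in B_R,\ t\ge 0.$$ -/

import Mathlib

open Set Filter Topology

noncomputable section

/-- Euclidean space `ℝⁿ`. -/
abbrev Rn (n : ℕ) : Type := EuclideanSpace ℝ (Fin n)

/-- The open punctured ball `B_R \ {0}` in `ℝⁿ`. -/
def puncturedBall (n : ℕ) (R : ℝ) : Set (Rn n) := Metric.ball 0 R \ {0}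

/-- The constant `α = (9n - 15)^(1/3)`. -/
def alpha (n : ℕ) : ℝ := (9 * (n : ℝ) - 15) ^ (1 / 3 : ℝ)

/-- The radial profile of the stationary solution, `u^*(r) = -α r^(1/3)`. -/
def ustar (n : ℕ) (r : ℝ) : ℝ := -alpha n * r ^ (1 / 3 : ℝ)

/-- The exponent `ν = (1/6) √(36 n² - 96 n + 61)`. -/
def nu (n : ℕ) : ℝ := 1 / 6 * √(36 * (n : ℝ) ^ 2 - 96 * (n : ℝ) + 61)

/-- The radial derivative `f_r(x) = ∇f(x) · x/|x|`. -/
def radialDeriv {n : ℕ} (f : Rn n → ℝ) (x : Rn n) : ℝ := fderiv ℝ f x (‖x‖⁻¹ • x)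

/-- The conditions on the initial data `u₀ : B̄_R → ℝ`; values of `u₀` outside the closed ball
play no role. -/
structure AdmissibleInitialData (n : ℕ) (R : ℝ) (u₀ : Rn n → ℝ) : Prop where
  /-- `u₀ ∈ C²(B̄_R \ {0})`. -/
  contDiffOn : ContDiffOn ℝ 2 u₀ (Metric.closedBall 0 R \ {0})
  /-- `u₀` is radially symmetric. -/
  radial : ∀ x ∈ Metric.closedBall (0 : Rn n) R, ∀ y ∈ Metric.closedBall (0 : Rn n) R,
    ‖x‖ = ‖y‖ → u₀ x = u₀ y
  /-- `u₀ ≤ u^*`. -/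
  le_ustar : ∀ x ∈ Metric.closedBall (0 : Rn n) R \ {0}, u₀ x ≤ ustar n ‖x‖
  /-- `limsup_{r ↘ 0} |r^(3/2 - n - ν) (u^*(r) - u₀(r))| < ∞`. -/
  close_at_zero : IsBoundedUnder (· ≤ ·) (𝓝[≠] (0 : Rn n))
    (fun x => |‖x‖ ^ (3 / 2 - (n : ℝ) - nu n) * (ustar n ‖x‖ - u₀ x)|)
  /-- `u₀(R) = u^*(R)`. -/
  boundary : ∀ x ∈ Metric.sphere (0 : Rn n) R, u₀ x = ustar n R
  /-- `0 ≥ u₀ᵣ(r) ≥ -C r^(-2/3)` for `0 < r < R`. -/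
  deriv_bound : ∃ C : ℝ, 0 < C ∧ ∀ x ∈ puncturedBall n R,
    radialDeriv u₀ x ≤ 0 ∧ -C * ‖x‖ ^ (-(2 / 3) : ℝ) ≤ radialDeriv u₀ x

/-- `u ∈ C^{2,1}(U × I)` for open `U ⊆ ℝⁿ`, `I ⊆ ℝ`: the function, its spatial derivatives up to
order two and its time derivative exist and are jointly continuous on `U × I`. -/
structure IsC21On {n : ℕ} (u : Rn n → ℝ → ℝ) (U : Set (Rn n)) (I : Set ℝ) : Prop where
  contDiffOn_space : ∀ t ∈ I, ContDiffOn ℝ 2 (fun x => u x t) U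
  differentiableOn_time : ∀ x ∈ U, DifferentiableOn ℝ (u x) I
  continuousOn : ContinuousOn (fun p : Rn n × ℝ => u p.1 p.2) (U ×ˢ I)
  continuousOn_fderiv :
    ContinuousOn (fun p : Rn n × ℝ => fderiv ℝ (fun x => u x p.2) p.1) (U ×ˢ I)
  continuousOn_fderiv_two :
    ContinuousOn (fun p : Rn n × ℝ => iteratedFDeriv ℝ 2 (fun x => u x p.2) p.1) (U ×ˢ I)
  continuousOn_deriv_time :
    ContinuousOn (fun p : Rn n × ℝ => deriv (u p.1) p.2) (U ×ˢ I)

/-- `u ∈ C(B̄_R × [0,∞)) ∩ C^{2,1}((B_R \ {0}) × (0,∞))` solves, in the classical sense,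
`u_t = Δu + u u_r³` in `(B_R \ {0}) × (0,∞)`, with `u(0,t) = 0` and `u = u^*(R)` on `∂B_R` for all
`t > 0`, and `u(·,0) = u₀` in `B̄_R`. -/
structure IsClassicalSolution (n : ℕ) (R : ℝ) (u₀ : Rn n → ℝ) (u : Rn n → ℝ → ℝ) : Prop where
  continuousOn :
    ContinuousOn (fun p : Rn n × ℝ => u p.1 p.2) (Metric.closedBall 0 R ×ˢ Ici 0)
  c21 : IsC21On u (puncturedBall n R) (Ioi 0)
  equation : ∀ x ∈ puncturedBall n R, ∀ t : ℝ, 0 < t →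
    deriv (u x) t =
      Laplacian.laplacian (fun y => u y t) x
        + u x t * radialDeriv (fun y => u y t) x ^ 3
  center : ∀ t : ℝ, 0 < t → u 0 t = 0
  boundary : ∀ x ∈ Metric.sphere (0 : Rn n) R, ∀ t : ℝ, 0 < t → u x t = ustar n R
  initial : ∀ x ∈ Metric.closedBall (0 : Rn n) R, u x 0 = u₀ x

end

/-!
# Exponential convergence to the singular stationary solution

The stationary solution is `u^* = -α r^(1/3)`. The idea is to compare `u` with functions of the form
`W = -β(t) r^(1/3)`. Writing `c = r^(1/3)`, one has `ΔW = -β (3n - 5) / 9 c⁻⁵` and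
`W W_r³ = β⁴ / 27 c⁻⁵`, and `α³ = 9n - 15`, so that
`ΔW + W W_r³ - W_t = β (β³ - α³) / 27 c⁻⁵ + β' c`.
For `β = α` this vanishes. For `β = α + A exp (-μ t)` it is nonnegative as soon as
`μ R² ≤ α³ / 27`, whatever `A > 0` is, so `W` is then a subsolution. The growth condition on `u₀` at
the origin gives an `A` with `W ≤ u₀` (`AdmissibleInitialData.exists_lower_bound`), and comparison
yields `-(α + A exp (-μ t)) r^(1/3) ≤ u ≤ u^*`, which is the claim.

Comparison (`IsClassicalSolution.comparison`) is available although the equation is cubic in the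
gradient and `W_r` is singular at the origin. By continuity up to the origin, where `u` and `W` both
vanish, a violation would produce a negative minimum of `u - W` (or of `W - u`) in the punctured
ball; there the gradients agree, `Δ(u - W)` has a sign by `IsLocalMin.laplacian_nonneg`, and
`u u_r³ - W W_r³ = (u - W) W_r³` has a strict sign because `W_r < 0`. In particular `u` itself need
not be radial.
-/

/-! ### Second derivatives along lines, and the Laplacian of a power of the norm -/

section Calculus

variable {E : Type*} [NormedAddCommGroup E] [InnerProductSpace ℝ E]

lemma eventually_hasDerivAt_line {f : E → ℝ} {x : E} (hf : ContDiffAt ℝ 2 f x) (e : E) :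
    ∀ᶠ s : ℝ in 𝓝 0, HasDerivAt (fun s : ℝ => f (x + s • e)) (fderiv ℝ f (x + s • e) e) s := by
  have hc : Tendsto (fun s : ℝ => x + s • e) (𝓝 0) (𝓝 x) := by
    have : Continuous (fun s : ℝ => x + s • e) := by fun_prop
    simpa using this.tendsto 0
  filter_upwards [hc.eventually (hf.eventually (by simp))] with s hs
  have h1 : HasDerivAt (fun s : ℝ => x + s • e) e s := by
    simpa using ((hasDerivAt_id s).smul_const e).const_add x
  exact (hs.differentiableAt (by simp)).hasFDerivAt.comp_hasDerivAt s h1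

lemma hasDerivAt_deriv_line {f : E → ℝ} {x : E} (hf : ContDiffAt ℝ 2 f x) (e : E) :
    HasDerivAt (deriv fun s : ℝ => f (x + s • e)) (iteratedFDeriv ℝ 2 f x ![e, e]) 0 := by
  have h1 : HasDerivAt (fun s : ℝ => x + s • e) e 0 := by
    simpa using ((hasDerivAt_id (0 : ℝ)).smul_const e).const_add x
  have h2 : HasFDerivAt (fderiv ℝ f) (fderiv ℝ (fderiv ℝ f) x) (x + (0 : ℝ) • e) := by
    have h : DifferentiableAt ℝ (fderiv ℝ f) x :=
      (hf.fderiv_right (m := 1) (by norm_num)).differentiableAt (by simp)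
    rw [zero_smul, add_zero]
    exact h.hasFDerivAt
  have h3 := h2.comp_hasDerivAt (0 : ℝ) h1
  have h4 : HasDerivAt (fun s : ℝ => fderiv ℝ f (x + s • e) e)
      (iteratedFDeriv ℝ 2 f x ![e, e]) 0 := by
    rw [iteratedFDeriv_two_apply]
    exact (ContinuousLinearMap.apply ℝ ℝ e).hasFDerivAt.comp_hasDerivAt (0 : ℝ) h3
  refine h4.congr_of_eventuallyEq ?_
  filter_upwards [eventually_hasDerivAt_line hf e] with s hs using hs.deriv

lemma IsLocalMin.deriv_deriv_nonneg {g : ℝ → ℝ} {a : ℝ} (h : IsLocalMin g a)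
    (hg : ContinuousAt g a) : 0 ≤ deriv (deriv g) a := by
  by_contra! hneg
  -- a negative second derivative would make `a` a local maximum too, hence `g` locally constant
  have hmax := isLocalMax_of_deriv_deriv_neg hneg h.deriv_eq_zero hg
  have hconst : g =ᶠ[𝓝 a] fun _ => g a := by
    filter_upwards [h, hmax] with y h1 h2 using le_antisymm h2 h1
  have := hconst.deriv.deriv_eq
  simp at this
  linarith

/-- Second-order necessary condition: restrict `f` to lines through `x`. -/
lemma IsLocalMin.laplacian_nonneg [FiniteDimensional ℝ E] {f : E → ℝ} {x : E}
    (h : IsLocalMin f x) (hf : ContDiffAt ℝ 2 f x) : 0 ≤ Laplacian.laplacian f x := by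
  rw [InnerProductSpace.laplacian_eq_iteratedFDeriv_stdOrthonormalBasis]
  refine Finset.sum_nonneg fun i _ => ?_
  set e := stdOrthonormalBasis ℝ E i
  rw [← (hasDerivAt_deriv_line hf e).deriv]
  have hc : ContinuousAt (fun s : ℝ => x + s • e) 0 := by fun_prop
  have hx : x + (0 : ℝ) • e = x := by simp
  refine IsLocalMin.deriv_deriv_nonneg ?_ ?_
  · have : Tendsto (fun s : ℝ => x + s • e) (𝓝 0) (𝓝 x) := by simpa using hc.tendsto
    filter_upwards [this.eventually h] with s hs
    simpa using hs
  · exact ContinuousAt.comp (f := fun s : ℝ => x + s • e) (by simpa using hf.continuousAt) hc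

lemma contDiffAt_norm_sq_rpow {x : E} (hx : x ≠ 0) (q : ℝ) :
    ContDiffAt ℝ 2 (fun y : E => (‖y‖ ^ 2) ^ q) x :=
  (contDiff_norm_sq ℝ).contDiffAt.rpow_const_of_ne (by positivity)

lemma hasFDerivAt_norm_sq_rpow {x : E} (hx : x ≠ 0) (q : ℝ) :
    HasFDerivAt (fun y : E => (‖y‖ ^ 2) ^ q)
      ((2 * q * (‖x‖ ^ 2) ^ (q - 1)) • innerSL ℝ x) x := by
  have := (hasStrictFDerivAt_norm_sq x).hasFDerivAt.rpow_const (p := q)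
    (Or.inl (by positivity))
  convert this using 1
  ext y
  simp
  ring

lemma iteratedFDeriv_two_norm_sq_rpow {x : E} (hx : x ≠ 0) (q : ℝ) (e : E) :
    iteratedFDeriv ℝ 2 (fun y : E => (‖y‖ ^ 2) ^ q) x ![e, e] =
      2 * q * (2 * (q - 1) * (‖x‖ ^ 2) ^ (q - 2) * inner ℝ x e ^ 2
        + (‖x‖ ^ 2) ^ (q - 1) * ‖e‖ ^ 2) := by
  have h1 : HasDerivAt (fun s : ℝ => x + s • e) e 0 := by
    simpa using ((hasDerivAt_id (0 : ℝ)).smul_const e).const_add x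
  have hx0 : x + (0 : ℝ) • e ≠ 0 := by simpa using hx
  have h2 := (hasFDerivAt_norm_sq_rpow hx0 (q - 1)).comp_hasDerivAt (0 : ℝ) h1
  have h3 : HasDerivAt (fun s : ℝ => inner ℝ (x + s • e) e) (‖e‖ ^ 2) 0 := by
    simpa using h1.inner ℝ (hasDerivAt_const (0 : ℝ) e)
  have h4 := (h2.mul h3).const_mul (2 * q)
  have h5 := hasDerivAt_deriv_line (contDiffAt_norm_sq_rpow hx q) e
  have h6 : (deriv fun s : ℝ => (‖x + s • e‖ ^ 2) ^ q) =ᶠ[𝓝 0]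
      fun s : ℝ => 2 * q * ((‖x + s • e‖ ^ 2) ^ (q - 1) * inner ℝ (x + s • e) e) := by
    have hc : ContinuousAt (fun s : ℝ => x + s • e) 0 := by fun_prop
    filter_upwards [eventually_hasDerivAt_line (contDiffAt_norm_sq_rpow hx q) e,
      hc.eventually_ne hx0] with s hs hs0
    rw [hs.deriv, (hasFDerivAt_norm_sq_rpow hs0 q).fderiv]
    simp [inner_add_left, real_inner_smul_left]
    ring
  rw [← h5.deriv, h6.deriv_eq]
  refine h4.deriv.trans ?_
  have : q - 1 - 1 = q - 2 := by ring
  simp [this]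
  left
  ring

lemma laplacian_norm_sq_rpow [FiniteDimensional ℝ E] {x : E} (hx : x ≠ 0) (q : ℝ) :
    Laplacian.laplacian (fun y : E => (‖y‖ ^ 2) ^ q) x =
      2 * q * (Module.finrank ℝ E + 2 * q - 2) * (‖x‖ ^ 2) ^ (q - 1) := by
  have hpow : (‖x‖ ^ 2) ^ (q - 1) = (‖x‖ ^ 2) ^ (q - 2) * ‖x‖ ^ 2 := by
    have : q - 1 = (q - 2) + 1 := by ring
    rw [this, Real.rpow_add_one (by positivity)]
  have hsum := (stdOrthonormalBasis ℝ E).sum_sq_inner_left x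
  rw [InnerProductSpace.laplacian_eq_iteratedFDeriv_stdOrthonormalBasis]
  simp only [iteratedFDeriv_two_norm_sq_rpow hx, ← Finset.mul_sum, Finset.sum_add_distrib]
  simp only [OrthonormalBasis.norm_eq_one, hsum]
  simp
  rw [hpow]
  ring

end Calculus

lemma HasDerivAt.nonpos_of_isMinOn_Icc {g : ℝ → ℝ} {g' a t : ℝ} (hg : HasDerivAt g g' t)
    (hat : a < t) (hmin : IsMinOn g (Icc a t) t) : g' ≤ 0 := by
  have h := (hasDerivWithinAt_iff_tendsto_slope' (by simp)).1 (hg.hasDerivWithinAt (s := Iio t))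
  refine le_of_tendsto h ?_
  filter_upwards [Ioo_mem_nhdsLT hat] with s hs
  have h1 : g t ≤ g s := hmin ⟨hs.1.le, hs.2.le⟩
  rw [slope_def_field]
  exact div_nonpos_of_nonneg_of_nonpos (by linarith) (by linarith [hs.2])

/-! ### The parabolic minimum principle -/

lemma isOpen_puncturedBall (n : ℕ) (R : ℝ) : IsOpen (puncturedBall n R) :=
  Metric.isOpen_ball.sdiff isClosed_singleton

/-- Skeleton of the parabolic minimum principle on the punctured ball: a function that is
nonnegative initially, on the sphere and at the origin, and for which no point can be both a spatial
local minimum and a minimum over the past with a negative value, is nonnegative. -/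
lemma nonneg_of_no_negative_interior_min {n : ℕ} {R T : ℝ} (hT : 0 ≤ T) {f : Rn n → ℝ → ℝ}
    (hf : ContinuousOn (fun p : Rn n × ℝ => f p.1 p.2) (Metric.closedBall 0 R ×ˢ Icc 0 T))
    (hinit : ∀ x ∈ Metric.closedBall (0 : Rn n) R, 0 ≤ f x 0)
    (hcenter : ∀ t, 0 < t → 0 ≤ f 0 t)
    (hbdry : ∀ x ∈ Metric.sphere (0 : Rn n) R, ∀ t, 0 < t → 0 ≤ f x t)
    (hint : ∀ x ∈ puncturedBall n R, ∀ t, 0 < t → f x t < 0 → IsLocalMin (fun y => f y t) x →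
      IsMinOn (f x) (Icc 0 t) t → False) :
    ∀ x ∈ Metric.closedBall (0 : Rn n) R, 0 ≤ f x T := by
  intro x hx
  obtain ⟨⟨y, t⟩, ⟨hy, ht⟩, hmin⟩ :=
    ((isCompact_closedBall (0 : Rn n) R).prod isCompact_Icc).exists_isMinOn
      ⟨(x, T), hx, hT, le_rfl⟩ hf
  have hmin' : ∀ z ∈ Metric.closedBall (0 : Rn n) R, ∀ s ∈ Icc 0 T, f y t ≤ f z s :=
    fun z hz s hs => hmin (show (z, s) ∈ _ from ⟨hz, hs⟩)
  by_contra! hneg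
  have hyt : f y t < 0 := (hmin' x hx T ⟨hT, le_rfl⟩).trans_lt hneg
  simp only at hy ht
  have ht0 : 0 < t := by
    rcases ht.1.eq_or_lt with h | h
    · rw [← h] at hyt
      exact absurd (hinit y hy) hyt.not_ge
    · exact h
  have hy0 : y ≠ 0 := by
    rintro rfl
    exact hyt.not_ge (hcenter t ht0)
  have hyR : y ∈ Metric.ball (0 : Rn n) R := by
    rcases (Metric.mem_closedBall.1 hy).lt_or_eq with h | h
    · exact h
    · exact absurd (hbdry y h t ht0) hyt.not_ge
  refine hint y ⟨hyR, hy0⟩ t ht0 hyt ?_ fun s hs => hmin' y hy s ⟨hs.1, hs.2.trans ht.2⟩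
  filter_upwards [Metric.isOpen_ball.mem_nhds hyR] with z hz
  exact hmin' z (Metric.ball_subset_closedBall hz) t ht

/-! ### The radial power `‖x‖ ^ (1 / 3)` -/

section RadialPower

variable {n : ℕ}

lemma norm_rpow_third_eq (x : Rn n) : ‖x‖ ^ (1 / 3 : ℝ) = (‖x‖ ^ 2) ^ (1 / 6 : ℝ) := by
  rw [← Real.rpow_natCast, ← Real.rpow_mul (norm_nonneg x)]
  norm_num

lemma norm_sq_rpow_sub_one (x : Rn n) :
    (‖x‖ ^ 2) ^ (1 / 6 - 1 : ℝ) = ((‖x‖ ^ (1 / 3 : ℝ)) ^ 5)⁻¹ := by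
  rw [← Real.rpow_natCast, ← Real.rpow_natCast, ← Real.rpow_mul (norm_nonneg x),
    ← Real.rpow_mul (norm_nonneg x), ← Real.rpow_neg (norm_nonneg x)]
  norm_num

lemma rpow_third_pow_three {r : ℝ} (hr : 0 ≤ r) : (r ^ (1 / 3 : ℝ)) ^ 3 = r := by
  rw [← Real.rpow_natCast, ← Real.rpow_mul hr]
  norm_num

lemma contDiffAt_norm_rpow_third {x : Rn n} (hx : x ≠ 0) :
    ContDiffAt ℝ 2 (fun y : Rn n => ‖y‖ ^ (1 / 3 : ℝ)) x := by
  simp only [norm_rpow_third_eq]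
  exact contDiffAt_norm_sq_rpow hx _

lemma laplacian_norm_rpow_third {x : Rn n} (hx : x ≠ 0) :
    Laplacian.laplacian (fun y : Rn n => ‖y‖ ^ (1 / 3 : ℝ)) x =
      (3 * n - 5) / 9 * ((‖x‖ ^ (1 / 3 : ℝ)) ^ 5)⁻¹ := by
  rw [← norm_sq_rpow_sub_one]
  simp only [norm_rpow_third_eq]
  rw [laplacian_norm_sq_rpow hx, finrank_euclideanSpace_fin]
  ring

lemma radialDeriv_norm_rpow_third {x : Rn n} (hx : x ≠ 0) :
    radialDeriv (fun y : Rn n => ‖y‖ ^ (1 / 3 : ℝ)) x =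
      1 / 3 * ((‖x‖ ^ (1 / 3 : ℝ)) ^ 2)⁻¹ := by
  have hr := rpow_third_pow_three (norm_nonneg x)
  have hx' : 0 < ‖x‖ := norm_pos_iff.2 hx
  have hc : 0 < ‖x‖ ^ (1 / 3 : ℝ) := by positivity
  have h : fderiv ℝ (fun y : Rn n => ‖y‖ ^ (1 / 3 : ℝ)) x =
      (2 * (1 / 6) * (‖x‖ ^ 2) ^ (1 / 6 - 1 : ℝ)) • innerSL ℝ x := by
    simp only [norm_rpow_third_eq]
    exact (hasFDerivAt_norm_sq_rpow hx _).fderiv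
  rw [radialDeriv, h, norm_sq_rpow_sub_one]
  simp only [smul_apply, innerSL_apply_apply, real_inner_smul_right,
    real_inner_self_eq_norm_sq, smul_eq_mul]
  generalize ‖x‖ ^ (1 / 3 : ℝ) = c at *
  rw [← hr]
  field_simp
  ring

end RadialPower

/-! ### Comparison with `-β(t) ‖x‖ ^ (1 / 3)` and convergence -/

lemma alpha_pos {n : ℕ} (hn : 2 ≤ n) : 0 < alpha n := by
  have : (2 : ℝ) ≤ n := by exact_mod_cast hn
  exact Real.rpow_pos_of_pos (by linarith) _

lemma alpha_pow_three {n : ℕ} (hn : 2 ≤ n) : alpha n ^ 3 = 9 * n - 15 := by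
  have : (2 : ℝ) ≤ n := by exact_mod_cast hn
  exact rpow_third_pow_three (by linarith)

/-- Comparison of a solution `u` with `-β(t) r^(1/3)`: the function lies below `u` if `σ > 0` and
above `u` if `σ < 0`. The hypothesis `hbarrier`, with `c = r^(1/3)`, says that `-β(t) r^(1/3)` is a
subsolution, respectively a supersolution. At an interior negative minimum of the
signed difference the gradients agree, so the reaction terms differ by the difference of the
functions times the cube of the (negative) radial derivative of `-β(t) r^(1/3)`, and this has a
strict sign. No bound on the gradient of `u` enters. -/
lemma IsClassicalSolution.comparison {n : ℕ} (hn : 2 ≤ n) {R : ℝ} {u₀ : Rn n → ℝ}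
    {u : Rn n → ℝ → ℝ} (hu : IsClassicalSolution n R u₀ u) {σ : ℝ} (hσ : σ ≠ 0)
    {β β' : ℝ → ℝ} (hβ : ∀ t, HasDerivAt β (β' t) t) (hβpos : ∀ t, 0 < β t)
    (hbarrier : ∀ t, 0 < t → ∀ c, 0 < c → c ^ 3 < R →
      0 ≤ σ * (β t * (β t ^ 3 - alpha n ^ 3) / 27 * (c ^ 5)⁻¹ + β' t * c))
    (hinit : ∀ x ∈ Metric.closedBall (0 : Rn n) R, 0 ≤ σ * (u₀ x + β 0 * ‖x‖ ^ (1 / 3 : ℝ)))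
    (hbdry : ∀ t, 0 < t → 0 ≤ σ * (ustar n R + β t * R ^ (1 / 3 : ℝ)))
    {t : ℝ} (ht : 0 ≤ t) {x : Rn n} (hx : x ∈ Metric.closedBall (0 : Rn n) R) :
    0 ≤ σ * (u x t + β t * ‖x‖ ^ (1 / 3 : ℝ)) := by
  have hβc : Continuous β := continuous_iff_continuousAt.2 fun t => (hβ t).continuousAt
  refine nonneg_of_no_negative_interior_min (f := fun x t => σ * (u x t + β t * ‖x‖ ^ (1 / 3 : ℝ)))
    ht ?_ ?_ ?_ ?_ ?_ x hx
  · have h1 := hu.continuousOn.mono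
      (prod_mono_right (s := Metric.closedBall (0 : Rn n) R) (Icc_subset_Ici_self : Icc 0 t ⊆ _))
    have h2 : Continuous fun p : Rn n × ℝ => β p.2 * ‖p.1‖ ^ (1 / 3 : ℝ) :=
      (hβc.comp continuous_snd).mul
        (continuous_fst.norm.rpow_const fun _ => Or.inr (by norm_num))
    exact continuousOn_const.mul (h1.add h2.continuousOn)
  · intro x hx
    simpa only [hu.initial x hx] using hinit x hx
  · intro t ht
    simp [hu.center t ht]
  · intro x hx t ht
    simpa only [hu.boundary x hx t ht, mem_sphere_zero_iff_norm.1 hx] using hbdry t ht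
  · intro x hx t ht hneg hmin hmint
    have hx0 : x ≠ 0 := hx.2
    have hnhds := (isOpen_puncturedBall n R).mem_nhds hx
    have hud : ContDiffAt ℝ 2 (fun y => u y t) x :=
      (hu.c21.contDiffOn_space t ht).contDiffAt hnhds
    have hkd := contDiffAt_norm_rpow_third hx0
    have hbk : ContDiffAt ℝ 2 (β t • fun y : Rn n => ‖y‖ ^ (1 / 3 : ℝ)) x :=
      contDiffAt_const.smul hkd
    have hsum : ContDiffAt ℝ 2
        ((fun y => u y t) + β t • fun y : Rn n => ‖y‖ ^ (1 / 3 : ℝ)) x := hud.add hbk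
    -- first and second order conditions at the minimum
    have hgrad : fderiv ℝ (fun y => u y t) x =
        -(β t • fderiv ℝ (fun y : Rn n => ‖y‖ ^ (1 / 3 : ℝ)) x) := by
      have h1 : HasFDerivAt (fun y => σ * (u y t + β t * ‖y‖ ^ (1 / 3 : ℝ)))
          (σ • (fderiv ℝ (fun y => u y t) x +
            β t • fderiv ℝ (fun y : Rn n => ‖y‖ ^ (1 / 3 : ℝ)) x)) x :=
        ((hud.differentiableAt (by simp)).hasFDerivAt.add
          ((hkd.differentiableAt (by simp)).hasFDerivAt.const_mul _)).const_mul σ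
      have h2 := hmin.hasFDerivAt_eq_zero h1
      exact eq_neg_of_add_eq_zero_left ((smul_eq_zero.1 h2).resolve_left hσ)
    have hrad : radialDeriv (fun y => u y t) x =
        -(β t * (1 / 3 * ((‖x‖ ^ (1 / 3 : ℝ)) ^ 2)⁻¹)) := by
      rw [← radialDeriv_norm_rpow_third hx0, radialDeriv, hgrad]
      rfl
    have hlap : 0 ≤ σ * (Laplacian.laplacian (fun y => u y t) x
        + β t * ((3 * n - 5) / 9 * ((‖x‖ ^ (1 / 3 : ℝ)) ^ 5)⁻¹)) := by
      have h1 := hmin.laplacian_nonneg (hsum.const_smul σ)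
      have h2 := InnerProductSpace.laplacian_smul σ hsum
      have h3 := hud.laplacian_add hbk
      have h4 := InnerProductSpace.laplacian_smul (β t) hkd
      rw [laplacian_norm_rpow_third hx0] at h4
      rw [h3, h4] at h2
      exact h1.trans_eq h2
    have htime : σ * (deriv (u x) t + β' t * ‖x‖ ^ (1 / 3 : ℝ)) ≤ 0 := by
      have h1 : HasDerivAt (u x) (deriv (u x) t) t :=
        ((hu.c21.differentiableOn_time x hx).differentiableAt (Ioi_mem_nhds ht)).hasDerivAt
      exact ((h1.add ((hβ t).mul_const _)).const_mul σ).nonpos_of_isMinOn_Icc ht hmint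
    rw [hu.equation x hx t ht, hrad] at htime
    have hx' : 0 < ‖x‖ := norm_pos_iff.2 hx0
    have hc : 0 < ‖x‖ ^ (1 / 3 : ℝ) := by positivity
    have hb := hbarrier t ht _ hc (by
      rw [rpow_third_pow_three hx'.le]
      exact mem_ball_zero_iff.1 hx.1)
    rw [alpha_pow_three hn] at hb
    have hβt := hβpos t
    generalize ‖x‖ ^ (1 / 3 : ℝ) = c at *
    -- the difference of the reaction terms has a strict sign
    have hstrict := mul_neg_of_pos_of_neg
      (show 0 < β t ^ 3 / 27 * (c ^ 6)⁻¹ by positivity) hneg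
    have hid : σ * (Laplacian.laplacian (fun y => u y t) x
          + u x t * (-(β t * (1 / 3 * (c ^ 2)⁻¹))) ^ 3 + β' t * c)
        = σ * (Laplacian.laplacian (fun y => u y t) x + β t * ((3 * n - 5) / 9 * (c ^ 5)⁻¹))
          + σ * (β t * (β t ^ 3 - (9 * n - 15)) / 27 * (c ^ 5)⁻¹ + β' t * c)
          - β t ^ 3 / 27 * (c ^ 6)⁻¹ * (σ * (u x t + β t * c)) := by
      field_simp
      ring
    linarith

/-- Near the origin this is the growth condition on `u₀`, since `n - 3 / 2 + ν ≥ 1 / 3`; away from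
the origin it is compactness. -/
lemma AdmissibleInitialData.exists_lower_bound {n : ℕ} (hn : 2 ≤ n) {R : ℝ} {u₀ : Rn n → ℝ}
    (h : AdmissibleInitialData n R u₀) :
    ∃ A : ℝ, 0 < A ∧ ∀ x ∈ Metric.closedBall (0 : Rn n) R \ {0},
      ustar n ‖x‖ - u₀ x ≤ A * ‖x‖ ^ (1 / 3 : ℝ) := by
  have hn' : (2 : ℝ) ≤ n := by exact_mod_cast hn
  obtain ⟨K, hK⟩ := h.close_at_zero
  rw [eventually_map, eventually_nhdsWithin_iff, Metric.eventually_nhds_iff] at hK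
  obtain ⟨δ, hδ, hK⟩ := hK
  obtain ⟨M, hM⟩ : ∃ M, ∀ x ∈ Metric.closedBall (0 : Rn n) R \ Metric.ball 0 (min δ 1),
      |u₀ x| ≤ M :=
    ((isCompact_closedBall (0 : Rn n) R).diff Metric.isOpen_ball).exists_bound_of_continuousOn
      (h.contDiffOn.continuousOn.mono (sdiff_subset_sdiff_right (by simp [hδ])))
  have hη : 0 < min δ 1 := lt_min hδ one_pos
  refine ⟨max (max K 1) (|M| / (min δ 1) ^ (1 / 3 : ℝ)), by positivity, fun x hx => ?_⟩
  have hx0 : x ≠ 0 := hx.2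
  have hx' : 0 < ‖x‖ := norm_pos_iff.2 hx0
  by_cases hxη : ‖x‖ < min δ 1
  · have h1 := hK (y := x) (by simpa using hxη.trans_le (min_le_left _ _)) hx0
    have hν : 0 ≤ nu n := by unfold nu; positivity
    -- multiply the growth condition by `‖x‖ ^ (n + ν - 3 / 2)`, an exponent larger than `1 / 3`
    have h2 : ‖x‖ ^ (-(3 / 2 - n - nu n)) ≤ ‖x‖ ^ (1 / 3 : ℝ) :=
      Real.rpow_le_rpow_of_exponent_ge hx' (hxη.le.trans (min_le_right _ _)) (by linarith)
    have h3 : ustar n ‖x‖ - u₀ x =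
        ‖x‖ ^ (3 / 2 - n - nu n) * (ustar n ‖x‖ - u₀ x) * ‖x‖ ^ (-(3 / 2 - n - nu n)) := by
      rw [Real.rpow_neg hx'.le]
      field_simp
    rw [h3]
    refine mul_le_mul ((le_abs_self _).trans (h1.trans ?_)) h2 (by positivity) (by positivity)
    exact (le_max_left _ _).trans (le_max_left _ _)
  · have hxη' := not_lt.1 hxη
    have h1 := hM x ⟨hx.1, fun h => hxη (mem_ball_zero_iff.1 h)⟩
    have h2 : ustar n ‖x‖ ≤ 0 := by
      have := alpha_pos hn
      unfold ustar
      rw [neg_mul, neg_nonpos]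
      positivity
    have h3 : (min δ 1) ^ (1 / 3 : ℝ) ≤ ‖x‖ ^ (1 / 3 : ℝ) := by gcongr
    have h4 : 0 < (min δ 1) ^ (1 / 3 : ℝ) := by positivity
    calc ustar n ‖x‖ - u₀ x ≤ |M| := by linarith [neg_abs_le (u₀ x), le_abs_self M]
      _ = |M| / (min δ 1) ^ (1 / 3 : ℝ) * (min δ 1) ^ (1 / 3 : ℝ) := by field_simp
      _ ≤ _ := mul_le_mul (le_max_right _ _) h3 h4.le (by positivity)

/-- The value of the initial data at the origin is prescribed only through the continuity of the
solution up to `t = 0`. -/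
lemma IsClassicalSolution.initial_center {n : ℕ} {R : ℝ} (hR : 0 < R) {u₀ : Rn n → ℝ}
    {u : Rn n → ℝ → ℝ} (hu : IsClassicalSolution n R u₀ u) : u₀ 0 = 0 := by
  have h0 : (0 : Rn n) ∈ Metric.closedBall (0 : Rn n) R := by simp [hR.le]
  rw [← hu.initial 0 h0]
  have h1 : ContinuousWithinAt (u 0) (Ici 0) 0 :=
    (hu.continuousOn.comp (by fun_prop : ContinuousOn (fun t : ℝ => ((0 : Rn n), t)) (Ici 0))
      fun t ht => ⟨h0, ht⟩) 0 self_mem_Ici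
  have h2 : Tendsto (u 0) (𝓝[>] 0) (𝓝 (u 0 0)) := h1.mono Ioi_subset_Ici_self
  refine tendsto_nhds_unique h2 (tendsto_const_nhds.congr' ?_)
  filter_upwards [self_mem_nhdsWithin] with t ht using (hu.center t ht).symm

theorem theorem3 (n : ℕ) (hn : 2 ≤ n) (R : ℝ) (hR : 0 < R)
    (hR' : R < √(3 / 8 * (3 * (n : ℝ) - 5) * (2 * (n : ℝ) - 3) ^ 3)) :
    ∃ μ : ℝ, 0 < μ ∧
      ∀ u₀ : Rn n → ℝ, AdmissibleInitialData n R u₀ →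
        ∃ C : ℝ, 0 < C ∧
          ∀ u : Rn n → ℝ → ℝ, IsClassicalSolution n R u₀ u →
            TendstoUniformlyOn (fun (t : ℝ) (x : Rn n) => u x t) (fun x => ustar n ‖x‖)
              atTop (Metric.ball 0 R) ∧
            ∀ t : ℝ, 0 ≤ t → ∀ x ∈ Metric.ball (0 : Rn n) R,
              |u x t - ustar n ‖x‖| ≤ C * Real.exp (-μ * t) := by
  have hα := alpha_pos hn
  -- `μ` makes `-(α + A exp (-μ t)) r^(1/3)` a subsolution for every `A > 0`
  set μ := alpha n ^ 3 / (27 * R ^ 2) with hμ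
  have hμpos : 0 < μ := by positivity
  refine ⟨μ, hμpos, fun u₀ h₀ => ?_⟩
  obtain ⟨A, hA, hlow⟩ := h₀.exists_lower_bound hn
  have hC : 0 < A * R ^ (1 / 3 : ℝ) := by positivity
  refine ⟨A * R ^ (1 / 3 : ℝ), hC, fun u hu => ?_⟩
  have hrate : ∀ t : ℝ, 0 ≤ t → ∀ x ∈ Metric.ball (0 : Rn n) R,
      |u x t - ustar n ‖x‖| ≤ A * R ^ (1 / 3 : ℝ) * Real.exp (-μ * t) := by
    intro t ht x hx
    have hx' := Metric.ball_subset_closedBall hx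
    have hupper : 0 ≤ -1 * (u x t + alpha n * ‖x‖ ^ (1 / 3 : ℝ)) := by
      refine hu.comparison hn (by norm_num) (β := fun _ => alpha n) (β' := fun _ => 0)
        (fun t => hasDerivAt_const t _) (fun _ => hα) (by simp) ?_ (by simp [ustar]) ht hx'
      intro y hy
      by_cases hy0 : y = 0
      · simp [hy0, hu.initial_center hR]
      · have := h₀.le_ustar y ⟨hy, hy0⟩
        simp only [ustar] at this
        linarith
    have hlower : 0 ≤ 1 * (u x t + (alpha n + A * Real.exp (-μ * t)) * ‖x‖ ^ (1 / 3 : ℝ)) := by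
      refine hu.comparison hn (by norm_num) (β := fun t => alpha n + A * Real.exp (-μ * t))
        (β' := fun t => -μ * (A * Real.exp (-μ * t))) ?_ (fun t => by positivity) ?_ ?_ ?_ ht hx'
      · intro t
        have h1 : HasDerivAt (fun t : ℝ => -μ * t) (-μ) t := by
          simpa using (hasDerivAt_id t).const_mul (-μ)
        exact ((h1.exp.const_mul A).const_add (alpha n)).congr_deriv (by ring)
      · intro t _ c hc hcR
        have hE : 0 < A * Real.exp (-μ * t) := by positivity
        generalize A * Real.exp (-μ * t) = E at *
        have hc6 : c ^ 6 ≤ R ^ 2 := by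
          calc c ^ 6 = (c ^ 3) ^ 2 := by ring
            _ ≤ R ^ 2 := by gcongr
        have h1 : μ * c ^ 6 ≤ alpha n ^ 3 / 27 := by
          calc μ * c ^ 6 ≤ μ * R ^ 2 := by gcongr
            _ = alpha n ^ 3 / 27 := by rw [hμ]; field_simp
        have h2 : alpha n ^ 3 * E ≤ (alpha n + E) * ((alpha n + E) ^ 3 - alpha n ^ 3) := by
          have hexp : (alpha n + E) * ((alpha n + E) ^ 3 - alpha n ^ 3) = alpha n ^ 3 * E +
            (2 * alpha n ^ 3 * E + 6 * alpha n ^ 2 * E ^ 2 + 4 * alpha n * E ^ 3 + E ^ 4) := by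
            ring
          rw [hexp]
          exact le_add_of_nonneg_right (by positivity)
        have h3 : 1 * ((alpha n + E) * ((alpha n + E) ^ 3 - alpha n ^ 3) / 27 * (c ^ 5)⁻¹
              + -μ * E * c) =
            ((alpha n + E) * ((alpha n + E) ^ 3 - alpha n ^ 3) / 27 - μ * c ^ 6 * E)
              * (c ^ 5)⁻¹ := by
          field_simp
          ring
        rw [h3]
        have h4 : μ * c ^ 6 * E ≤ alpha n ^ 3 / 27 * E := by gcongr
        exact mul_nonneg (by linarith) (by positivity)
      · intro y hy
        by_cases hy0 : y = 0
        · simp [hy0, hu.initial_center hR]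
        · have := hlow y ⟨hy, hy0⟩
          simp only [ustar] at this
          simp only [mul_zero, Real.exp_zero]
          linarith
      · intro t _
        simp only [ustar]
        have : 0 ≤ A * Real.exp (-μ * t) * R ^ (1 / 3 : ℝ) := by positivity
        linarith
    have hle : A * Real.exp (-μ * t) * ‖x‖ ^ (1 / 3 : ℝ) ≤
        A * Real.exp (-μ * t) * R ^ (1 / 3 : ℝ) := by
      have := (mem_ball_zero_iff.1 hx).le
      gcongr
    rw [ustar, abs_le]
    constructor
    · linarith
    · have : 0 ≤ A * R ^ (1 / 3 : ℝ) * Real.exp (-μ * t) := by positivity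
      linarith
  refine ⟨?_, hrate⟩
  have hlim : Tendsto (fun t : ℝ => A * R ^ (1 / 3 : ℝ) * Real.exp (-μ * t)) atTop (𝓝 0) := by
    have h1 : Tendsto (fun t : ℝ => -μ * t) atTop atBot :=
      tendsto_id.const_mul_atTop_of_neg (neg_neg_of_pos hμpos)
    simpa using (Real.tendsto_exp_atBot.comp h1).const_mul (A * R ^ (1 / 3 : ℝ))
  rw [Metric.tendstoUniformlyOn_iff]
  intro ε hε
  filter_upwards [hlim.eventually_lt_const hε, eventually_ge_atTop 0] with t ht ht0 x hx
  rw [dist_comm, Real.dist_eq]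
  exact (hrate t ht0 x hx).trans_lt ht
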